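/- **Setting.** An instance of weighted caching consists of a finite set $P$ of pages with weights $w_p>0$, a cache size $k\ge 1$ and an initial cache content $C_0\subseteq P$ with $|C_0|\le k$. An input $\sigma$ is a finite sequence of rounds; in round $i$ a page $r_i\in P$ is requested at a real time $t_i$, with $t_1<t_2<\cdots<t_T$. A solution is a sequence $C_1,\dots,C_T$ of cache contents with $r_i\in C_i\subseteq P$ and $|C_i|\le k$; its cost is $\sum_{i=1}^T\sum_{p\in C_i\setminus C_{i-1}} w_p$, i.e. the weight of a page is paid each time the page enters the cache. Let $\mathrm{OPT}(\sigma)$ be the minimum cost of a solution for $\sigma$. An algorithm is *semi-online* if in round $i$ it receives $r_i$, $t_i$ and, for every page $p$, the exact time of the next request to $p$ after $t_i$ ($\infty$ if there is none), and has to choose $C_i$ as a function of what it has received in rounds $1,\dots,i$. A *randomized* semi-online algorithm $A$ is a random deterministic semi-online algorithm (a random variable on some probability space). It is $\rho$-competitive on the instance if there is a constant $\alpha$, independent of the input, such that $\mathbb{E}[\mathrm{cost}(A(\sigma))]\le \rho\cdot \mathrm{OPT}(\sigma)+\alpha$ for every input $\sigma$. **Theorem.** Every randomized semi-online algorithm for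 weighted caching has competitive ratio $\Omega(\log k)$. That is, there is an absolute constant $c>0$ such that for every $k\ge 1$ there are positive weights on a set of $k+1$ pages such that, for every initial cache content with at most $k$ pages, every randomized semi-online algorithm with cache size $k$ that is $\rho$-competitive on this instance satisfies $\rho\ge c\log k$. -/

import Mathlib

open MeasureTheory

namespace WeightedCaching

/-- A request to a page, together with the (real) time at which it arrives. -/
structure Request (P : Type*) where
  page : P
  time : ℝ

/-- An input is a finite list of requests whose arrival times are strictly increasing. -/
def IsInput {P : Type*} (σ : List (Request P)) : Prop :=
  σ.Pairwise fun r s => r.time < s.time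

/-- What a semi-online algorithm receives in one round: the requested page, its arrival time and,
for every page, the exact time of the next request to that page (`⊤` if there is none). -/
structure Observation (P : Type*) where
  page : P
  time : ℝ
  next : P → WithTop ℝ

/-- The arrival time of the first request to `p` in a list of requests in order of arrival. -/
def nextTime {P : Type*} [DecidableEq P] : List (Request P) → P → WithTop ℝ
  | [], _ => ⊤
  | r :: rest, p => if r.page = p then (r.time : WithTop ℝ) else nextTime rest p

/-- The observations made in the successive rounds of an input. -/
def observations {P : Type*} [DecidableEq P] : List (Request P) → List (Observation P)
  | [] => []
  | r :: rest => ⟨r.page, r.time, nextTime rest⟩ :: observations rest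

/-- A deterministic semi-online algorithm with cache size `k`: from the observations of the past
rounds (oldest first) and that of the current round, it chooses the cache content with which it
serves the current request. -/
structure SemiOnlineAlgorithm (k : ℕ) (P : Type*) where
  serve : List (Observation P) → Observation P → Finset P
  page_mem_serve : ∀ past now, now.page ∈ serve past now
  card_serve_le : ∀ past now, (serve past now).card ≤ k

/-- The cache contents chosen on the given observations, after the observations `past`. -/
def SemiOnlineAlgorithm.run {k : ℕ} {P : Type*} (A : SemiOnlineAlgorithm k P) :
    List (Observation P) → List (Observation P) → List (Finset P)
  | _, [] => []
  | past, now :: later => A.serve past now :: A.run (past ++ [now]) later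

/-- The solution (list of successive cache contents) produced on the input `σ`. -/
def SemiOnlineAlgorithm.solution {k : ℕ} {P : Type*} [DecidableEq P]
    (A : SemiOnlineAlgorithm k P) (σ : List (Request P)) : List (Finset P) :=
  A.run [] (observations σ)

/-- The cost of passing through a list of cache contents, starting from the cache content `C`:
the weight of a page is paid each time the page enters the cache. -/
def cost {P : Type*} [DecidableEq P] (w : P → ℝ) : Finset P → List (Finset P) → ℝ
  | _, [] => 0
  | C, D :: rest => (∑ p ∈ D \ C, w p) + cost w D rest

/-- A list of cache contents of size at most `k`, one per request, each holding the page
requested. -/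
def IsSolution {P : Type*} (k : ℕ) (σ : List (Request P)) (S : List (Finset P)) : Prop :=
  List.Forall₂ (fun r C => r.page ∈ C ∧ C.card ≤ k) σ S

/-- The optimal offline cost of serving `σ` with initial cache `C₀`. -/
noncomputable def optCost {P : Type*} [DecidableEq P] (k : ℕ) (w : P → ℝ) (C₀ : Finset P)
    (σ : List (Request P)) : ℝ :=
  sInf {x : ℝ | ∃ S : List (Finset P), IsSolution k σ S ∧ x = cost w C₀ S}

/-- A randomized semi-online algorithm: a random deterministic one, over a probability space
whose points are the outcomes of the internal randomness. -/
structure RandomizedSemiOnlineAlgorithm (k : ℕ) (P : Type*) (Ω : Type*) [MeasurableSpace Ω] where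
  toFun : Ω → SemiOnlineAlgorithm k P
  measurableSet_serve_eq : ∀ past now C, MeasurableSet {ω | (toFun ω).serve past now = C}

/-- The expected cost of a randomized semi-online algorithm on the input `σ`. (For finitely many
pages the cost is a measurable function of `ω` with finitely many values.) -/
noncomputable def RandomizedSemiOnlineAlgorithm.expectedCost {k : ℕ} {P Ω : Type*} [DecidableEq P]
    [MeasurableSpace Ω] (A : RandomizedSemiOnlineAlgorithm k P Ω) (μ : Measure Ω)
    (w : P → ℝ) (C₀ : Finset P) (σ : List (Request P)) : ℝ :=
  ∫ ω, cost w C₀ ((A.toFun ω).solution σ) ∂μ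

/-- `A` is `ρ`-competitive on the weighted caching instance with page weights `w`, cache size `k`
and initial cache `C₀`. -/
def RandomizedSemiOnlineAlgorithm.IsCompetitive {k : ℕ} {P Ω : Type*} [DecidableEq P]
    [MeasurableSpace Ω] (A : RandomizedSemiOnlineAlgorithm k P Ω) (μ : Measure Ω)
    (w : P → ℝ) (C₀ : Finset P) (ρ : ℝ) : Prop :=
  ∃ α : ℝ, ∀ σ : List (Request P), IsInput σ →
    A.expectedCost μ w C₀ σ ≤ ρ * optCost k w C₀ σ + α

end WeightedCaching

/-! Page `p` gets weight `2 ^ p`, and there is one page more than fits. The adversary keeps the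
pages due in the order `0, 1, …, k`. A step of level `l` requests page `0` twice and then `1, …, l +
1`, which are afterwards rescheduled before page `l + 2`. Announced times therefore do not reveal
`l` when the first request to `0` is served, and `l` has tail `P(l ≥ j) = 2⁻ʲ`.

Online: the cache serving that request misses a page; let `h ≥ 1` be the largest one missing. With
probability `2 ^ (1 - h)` all pages up to `h` are then requested, which is worth `2 ^ h`. So
`progress`, the eviction cost minus the weight of the heaviest missing page, grows by at least `2`
per step on average (`progress_add_two_le`).

Offline: an interval of level `n` is a run of steps ended by one of level at least `n`. It can be
served by keeping the hole at page `n + 1` until its last step, for at most `2 ^ (n + 2)`, or by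
serving its subintervals of level `n - 1` separately (`serves_steps`). The number of subintervals is
geometric with mean `2`, so this is a ski-rental problem on every level. The rule "buy after `M`
subintervals" bounds the normalised expected cost by `freshValue M n`, which is `O(1 / M)` once `n ≥
2 ^ M` (`freshValue_le`). The offline cost per step is thus `O(1 / log k)`.

No random input is needed: a potential combining both costs improves on average over `l`, hence for
some `l`, and the levels are fixed one at a time (`exists_levels`). -/

namespace WeightedCaching

/-! ### The adversary's inputs and what they reveal. -/

section Game

variable {k : ℕ}

/-- Requests to the pages `a, …, a + n - 1` at the times given by `t`. -/
def block (k : ℕ) (t : ℕ → ℝ) (a n : ℕ) : List (Request (Fin (k + 1))) :=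
  (List.range' a n).map fun i => ⟨Fin.ofNat (k + 1) i, t i⟩

/-- One step of the adversary at level `l`, the pages being due at the times `t`: page `0` is
requested twice, then each of the pages `1, …, l + 1`. -/
noncomputable def step (k : ℕ) (t : ℕ → ℝ) (l : ℕ) : List (Request (Fin (k + 1))) :=
  ⟨0, t 0⟩ :: ⟨0, (t 0 + t 1) / 2⟩ :: block k t 1 (l + 1)

/-- The times at which the pages are due after a step at level `l`. -/
noncomputable def reschedule (t : ℕ → ℝ) (l : ℕ) (i : ℕ) : ℝ :=
  if i ≤ l + 1 then t (l + 1) + (i + 1) / (l + 3) * (t (l + 2) - t (l + 1)) else t i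

/-- The input consisting of steps at the given levels, and final requests to all pages. -/
noncomputable def gen (k : ℕ) : (ℕ → ℝ) → List ℕ → List (Request (Fin (k + 1)))
  | t, [] => block k t 0 (k + 1)
  | t, l :: ls => step k t l ++ gen k (reschedule t l) ls

/-- The fractions `(i + 1) / (l + 3)` with `i ≤ l + 1` lie strictly between `0` and `1`, so the
requested pages are due again, in order, inside the gap before page `l + 2`. Since `t` is defined on
all of `ℕ`, this gap exists even for `l + 1 = k`. -/
theorem strictMono_reschedule {t : ℕ → ℝ} (ht : StrictMono t) (l : ℕ) :
    StrictMono (reschedule t l) := by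
  refine strictMono_nat_of_lt_succ fun i => ?_
  have h0 : t (l + 1) < t (l + 2) := ht (by omega)
  have h1 : t i < t (i + 1) := ht (by omega)
  unfold reschedule
  split_ifs with ha hb hb
  · have : 0 < t (l + 2) - t (l + 1) := by linarith
    push_cast
    gcongr
    linarith
  · have : i = l + 1 := by omega
    subst this
    have h2 : (((l + 1 : ℕ) : ℝ) + 1) / (l + 3) < 1 := by
      rw [div_lt_one (by positivity)]; push_cast; linarith
    nlinarith
  · omega
  · exact h1

theorem lt_reschedule {t : ℕ → ℝ} (ht : StrictMono t) (l i : ℕ) :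
    t (l + 1) < reschedule t l i := by
  have h0 : t (l + 1) < t (l + 2) := ht (by omega)
  unfold reschedule
  split_ifs with h
  · have : 0 < ((i : ℝ) + 1) / (l + 3) * (t (l + 2) - t (l + 1)) :=
      mul_pos (by positivity) (by linarith)
    linarith
  · exact ht (by omega)

theorem mem_block {t : ℕ → ℝ} {a n : ℕ} {r : Request (Fin (k + 1))} :
    r ∈ block k t a n ↔ ∃ i, (a ≤ i ∧ i < a + n) ∧ ⟨Fin.ofNat (k + 1) i, t i⟩ = r := by
  simp [block, List.mem_range'_1]

theorem isInput_block {t : ℕ → ℝ} (ht : StrictMono t) (a n : ℕ) : IsInput (block k t a n) := by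
  unfold IsInput block
  rw [List.pairwise_map]
  exact (List.pairwise_lt_range' (s := a) (n := n)).imp fun h => ht h

theorem isInput_step {t : ℕ → ℝ} (ht : StrictMono t) (l : ℕ) : IsInput (step k t l) := by
  have h01 : t 0 < t 1 := ht (by omega)
  have hb : ∀ r ∈ block k t 1 (l + 1), t 1 ≤ r.time := by
    intro r hr
    obtain ⟨i, hi, rfl⟩ := mem_block.1 hr
    exact ht.monotone hi.1
  refine List.pairwise_cons.2 ⟨fun r hr => ?_, List.pairwise_cons.2 ⟨fun r hr => ?_,
    isInput_block ht _ _⟩⟩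
  · rcases List.mem_cons.1 hr with rfl | hr
    · dsimp only; linarith
    · have := hb r hr
      dsimp only; linarith
  · have := hb r hr
    dsimp only; linarith

theorem isInput_gen {t : ℕ → ℝ} (ht : StrictMono t) (ls : List ℕ) :
    IsInput (gen k t ls) ∧ ∀ r ∈ gen k t ls, t 0 ≤ r.time := by
  induction ls generalizing t with
  | nil =>
    refine ⟨isInput_block ht _ _, fun r hr => ?_⟩
    obtain ⟨i, -, rfl⟩ := mem_block.1 hr
    exact ht.monotone (Nat.zero_le i)
  | cons l ls ih =>
    obtain ⟨h1, h2⟩ := ih (strictMono_reschedule ht l)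
    have h01 : t 0 < t 1 := ht (by omega)
    have h1l : t 1 ≤ t (l + 1) := ht.monotone (by omega)
    have h3 := lt_reschedule ht l 0
    refine ⟨List.pairwise_append.2 ⟨isInput_step ht l, h1, fun r hr s hs => ?_⟩, fun r hr => ?_⟩
    · have h4 := h2 s hs
      have : r.time ≤ t (l + 1) := by
        simp only [step, List.mem_cons] at hr
        rcases hr with rfl | rfl | hr
        · dsimp only; linarith
        · dsimp only; linarith
        · obtain ⟨i, hi, rfl⟩ := mem_block.1 hr
          exact ht.monotone (by omega)
      linarith
    · simp only [gen, step, List.cons_append, List.mem_cons, List.mem_append] at hr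
      rcases hr with rfl | rfl | hr | hr
      · exact le_rfl
      · dsimp only; linarith
      · obtain ⟨i, hi, rfl⟩ := mem_block.1 hr
        exact ht.monotone (Nat.zero_le i)
      · have := h2 r hr
        linarith

/-- The next request time of each page, if the listed requests are followed by an input in which
the next request times are given by `f`. -/
def nextTimeFrom {P : Type*} [DecidableEq P] (f : P → WithTop ℝ) :
    List (Request P) → P → WithTop ℝ
  | [], p => f p
  | r :: rest, p => if r.page = p then (r.time : WithTop ℝ) else nextTimeFrom f rest p

/-- The observations made on the listed requests, if they are followed by an input in which the
next request times are given by `f`. -/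
def observationsFrom {P : Type*} [DecidableEq P] (f : P → WithTop ℝ) :
    List (Request P) → List (Observation P)
  | [] => []
  | r :: rest => ⟨r.page, r.time, nextTimeFrom f rest⟩ :: observationsFrom f rest

theorem nextTime_append {P : Type*} [DecidableEq P] (σ τ : List (Request P)) :
    nextTime (σ ++ τ) = nextTimeFrom (nextTime τ) σ := by
  induction σ with
  | nil => rfl
  | cons r σ ih => funext p; simp only [List.cons_append, nextTime, nextTimeFrom, ih]

theorem observations_append {P : Type*} [DecidableEq P] (σ τ : List (Request P)) :
    observations (σ ++ τ) = observationsFrom (nextTime τ) σ ++ observations τ := by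
  induction σ with
  | nil => rfl
  | cons r σ ih => simp only [List.cons_append, observations, observationsFrom, ih, nextTime_append]

theorem map_page_observationsFrom {P : Type*} [DecidableEq P] (f : P → WithTop ℝ)
    (σ : List (Request P)) :
    (observationsFrom f σ).map Observation.page = σ.map Request.page := by
  induction σ with
  | nil => rfl
  | cons r σ ih => simp only [observationsFrom, List.map_cons, ih]

theorem nextTimeFrom_block (f : Fin (k + 1) → WithTop ℝ) (t : ℕ → ℝ) {a n : ℕ}
    (h : a + n ≤ k + 1) (p : Fin (k + 1)) :
    nextTimeFrom f (block k t a n) p =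
      if a ≤ p.val ∧ p.val < a + n then (t p.val : WithTop ℝ) else f p := by
  induction n generalizing a with
  | zero =>
    rw [if_neg (by omega)]; rfl
  | succ n ih =>
    have e : block k t a (n + 1) = ⟨Fin.ofNat (k + 1) a, t a⟩ :: block k t (a + 1) n := by
      simp [block, List.range'_succ]
    have hv : (Fin.ofNat (k + 1) a).val = a := Nat.mod_eq_of_lt (by omega)
    rw [e, nextTimeFrom, ih (by omega)]
    by_cases hp : a = p.val
    · rw [if_pos (Fin.ext (hv.trans hp)), if_pos (by omega), hp]
    · rw [if_neg fun h' => hp (by rw [← h', hv])]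
      congr 1
      simp only [eq_iff_iff]; omega

theorem nextTimeFrom_step_tail {t : ℕ → ℝ} {l : ℕ} (hl : l < k) (p : Fin (k + 1)) (hp : p ≠ 0) :
    nextTimeFrom (fun p => (reschedule t l p.val : WithTop ℝ)) (block k t 1 (l + 1)) p =
      t p.val := by
  have hp0 : p.val ≠ 0 := fun h => hp (Fin.ext h)
  rw [nextTimeFrom_block _ _ (by omega)]
  split_ifs with h
  · rfl
  · rw [reschedule, if_neg (by omega)]

/-- The announced times depend on the current schedule only, not on the levels to come. The final
requests to all pages make this true also at the end of the input. -/
theorem nextTime_gen (t : ℕ → ℝ) {ls : List ℕ} (hls : ∀ l ∈ ls, l < k) :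
    nextTime (gen k t ls) = fun p => (t p.val : WithTop ℝ) := by
  induction ls generalizing t with
  | nil =>
    funext p
    have := nextTimeFrom_block (nextTime []) t (a := 0) (n := k + 1) (by omega) p
    rw [← nextTime_append, List.append_nil] at this
    rw [gen, this, if_pos (by omega)]
  | cons l ls ih =>
    rw [gen, nextTime_append, ih _ fun i hi => hls i (List.mem_cons_of_mem _ hi)]
    funext p
    simp only [step, nextTimeFrom]
    by_cases hp : 0 = p
    · subst hp; simp
    · rw [if_neg hp, if_neg hp,
        nextTimeFrom_step_tail (hls l List.mem_cons_self) p (Ne.symm hp)]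

/-- The observation made at the beginning of a step, whatever its level. -/
noncomputable def firstObservation (k : ℕ) (t : ℕ → ℝ) : Observation (Fin (k + 1)) :=
  ⟨0, t 0, fun p => if 0 = p then (((t 0 + t 1) / 2 : ℝ) : WithTop ℝ) else t p.val⟩

/-- The observations made in the remainder of a step at level `l`. -/
noncomputable def laterObservations (k : ℕ) (t : ℕ → ℝ) (l : ℕ) :
    List (Observation (Fin (k + 1))) :=
  observationsFrom (fun p => (reschedule t l p.val : WithTop ℝ))
    (⟨0, (t 0 + t 1) / 2⟩ :: block k t 1 (l + 1))

/-- The second request to page `0` hides the level: the first observation announces it as the next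
request to `0`, instead of the rescheduled time, which depends on `l`. -/
theorem observationsFrom_step (t : ℕ → ℝ) {l : ℕ} (hl : l < k) :
    observationsFrom (fun p => (reschedule t l p.val : WithTop ℝ)) (step k t l) =
      firstObservation k t :: laterObservations k t l := by
  unfold step firstObservation laterObservations
  rw [observationsFrom]
  congr 2
  funext p
  simp only [nextTimeFrom]
  by_cases hp : 0 = p
  · rw [if_pos hp, if_pos hp]
  · rw [if_neg hp, if_neg hp, nextTimeFrom_step_tail hl p (Ne.symm hp)]

theorem exists_mem_laterObservations (t : ℕ → ℝ) {l : ℕ} {p : Fin (k + 1)} (hp : p.val ≤ l + 1) :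
    ∃ o ∈ laterObservations k t l, o.page = p := by
  rw [← List.mem_map, laterObservations, map_page_observationsFrom, List.map_cons, List.mem_cons]
  by_cases h0 : p = 0
  · exact Or.inl h0
  · have : p.val ≠ 0 := fun h => h0 (Fin.ext h)
    refine Or.inr (List.mem_map.2 ⟨_, mem_block.2 ⟨p.val, by omega, rfl⟩, ?_⟩)
    exact Fin.ext (Nat.mod_eq_of_lt p.isLt)

/-- The observations made during the steps at the given levels. -/
noncomputable def history (k : ℕ) : (ℕ → ℝ) → List ℕ → List (Observation (Fin (k + 1)))
  | _, [] => []
  | t, l :: ls => (firstObservation k t :: laterObservations k t l) ++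
      history k (reschedule t l) ls

theorem observations_gen (t : ℕ → ℝ) {ls : List ℕ} (hls : ∀ l ∈ ls, l < k) :
    observations (gen k t ls) =
      history k t ls ++ observations (gen k (ls.foldl reschedule t) []) := by
  induction ls generalizing t with
  | nil => rfl
  | cons l ls ih =>
    have h := fun i hi => hls i (List.mem_cons_of_mem _ hi)
    change observations (step k t l ++ gen k (reschedule t l) ls) = _
    rw [observations_append, nextTime_gen _ h, ih _ h, history,
      observationsFrom_step _ (hls l List.mem_cons_self), List.append_assoc, List.foldl_cons]

theorem history_append_singleton (t : ℕ → ℝ) (ls : List ℕ) (l : ℕ) :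
    history k t (ls ++ [l]) = history k t ls ++
      (firstObservation k (ls.foldl reschedule t) ::
        laterObservations k (ls.foldl reschedule t) l) := by
  induction ls generalizing t with
  | nil => simp [history]
  | cons i ls ih => simp only [List.cons_append, history, ih, List.append_assoc, List.foldl_cons]

end Game

/-! ### Charging evictions instead of loads. -/

section Eviction

variable {P : Type*} [DecidableEq P]

/-- The last of a list of cache contents, or `C` if there is none. -/
def lastCache (C : Finset P) : List (Finset P) → Finset P
  | [] => C
  | D :: S => lastCache D S

/-- The total weight of the pages evicted on passing through a list of cache contents. -/
def evictionCost (w : P → ℝ) : Finset P → List (Finset P) → ℝ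
  | _, [] => 0
  | C, D :: S => (∑ p ∈ C \ D, w p) + evictionCost w D S

/-- The two cost measures differ only by the weights of the first and last cache, a bounded amount
that the additive constant absorbs. -/
theorem evictionCost_add_sum (w : P → ℝ) (C : Finset P) (S : List (Finset P)) :
    evictionCost w C S + ∑ p ∈ lastCache C S, w p = cost w C S + ∑ p ∈ C, w p := by
  induction S generalizing C with
  | nil => rfl
  | cons D S ih =>
    have h := ih D
    have h1 := Finset.sum_inter_add_sum_sdiff C D w
    have h2 := Finset.sum_inter_add_sum_sdiff D C w
    rw [Finset.inter_comm] at h2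
    simp only [evictionCost, cost, lastCache]
    linarith

theorem lastCache_append {P : Type*} (C : Finset P) (S T : List (Finset P)) :
    lastCache C (S ++ T) = lastCache (lastCache C S) T := by
  induction S generalizing C with
  | nil => rfl
  | cons D S ih => exact ih D

theorem evictionCost_append (w : P → ℝ) (C : Finset P) (S T : List (Finset P)) :
    evictionCost w C (S ++ T) = evictionCost w C S + evictionCost w (lastCache C S) T := by
  induction S generalizing C with
  | nil => simp [evictionCost, lastCache]
  | cons D S ih => simp only [List.cons_append, evictionCost, lastCache, ih, add_assoc]

theorem cost_append (w : P → ℝ) (C : Finset P) (S T : List (Finset P)) :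
    cost w C (S ++ T) = cost w C S + cost w (lastCache C S) T := by
  induction S generalizing C with
  | nil => simp [cost, lastCache]
  | cons D S ih => simp only [List.cons_append, cost, lastCache, ih, add_assoc]

theorem cost_nonneg {w : P → ℝ} (hw : ∀ p, 0 ≤ w p) (C : Finset P) (S : List (Finset P)) :
    0 ≤ cost w C S := by
  induction S generalizing C with
  | nil => exact le_rfl
  | cons D S ih => exact add_nonneg (Finset.sum_nonneg fun p _ => hw p) (ih D)

theorem evictionCost_nonneg {w : P → ℝ} (hw : ∀ p, 0 ≤ w p) (C : Finset P)
    (S : List (Finset P)) : 0 ≤ evictionCost w C S := by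
  induction S generalizing C with
  | nil => exact le_rfl
  | cons D S ih => exact add_nonneg (Finset.sum_nonneg fun p _ => hw p) (ih D)

theorem le_evictionCost {w : P → ℝ} (hw : ∀ p, 0 ≤ w p) {C : Finset P} {S : List (Finset P)}
    {p : P} (hp : ∃ D ∈ C :: S, p ∈ D) (hlast : p ∉ lastCache C S) : w p ≤ evictionCost w C S := by
  induction S generalizing C with
  | nil =>
    obtain ⟨D, hD, hpD⟩ := hp
    rw [List.mem_singleton.1 hD] at hpD
    exact absurd hpD hlast
  | cons E S ih =>
    have h0 : 0 ≤ ∑ q ∈ C \ E, w q := Finset.sum_nonneg fun p _ => hw p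
    by_cases h : ∃ D ∈ E :: S, p ∈ D
    · have := ih h hlast
      rw [evictionCost]; linarith
    · have hC : p ∈ C := by
        obtain ⟨D, hD, hpD⟩ := hp
        rcases List.mem_cons.1 hD with rfl | hD
        · exact hpD
        · exact absurd ⟨D, hD, hpD⟩ h
      have hE : p ∉ E := fun hpE => h ⟨E, List.mem_cons_self, hpE⟩
      have h1 : w p ≤ ∑ q ∈ C \ E, w q :=
        Finset.single_le_sum (f := w) (fun q _ => hw q) (Finset.mem_sdiff.2 ⟨hC, hE⟩)
      have := evictionCost_nonneg hw E S
      rw [evictionCost]; linarith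

end Eviction

namespace SemiOnlineAlgorithm

variable {k : ℕ} {P : Type*} (A : SemiOnlineAlgorithm k P)

theorem run_append (past o₁ o₂ : List (Observation P)) :
    A.run past (o₁ ++ o₂) = A.run past o₁ ++ A.run (past ++ o₁) o₂ := by
  induction o₁ generalizing past with
  | nil => simp [run]
  | cons o o₁ ih => simp [run, ih]

theorem length_run (past os : List (Observation P)) : (A.run past os).length = os.length := by
  induction os generalizing past with
  | nil => rfl
  | cons o os ih => simp [run, ih]

theorem exists_page_mem_run (past : List (Observation P)) {os : List (Observation P)}
    {o : Observation P} (ho : o ∈ os) : ∃ D ∈ A.run past os, o.page ∈ D := by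
  induction os generalizing past with
  | nil => simp at ho
  | cons o' os ih =>
    rcases List.mem_cons.1 ho with rfl | ho
    · exact ⟨_, List.mem_cons_self, A.page_mem_serve _ _⟩
    · obtain ⟨D, hD, h⟩ := ih (past ++ [o']) ho
      exact ⟨D, List.mem_cons_of_mem _ hD, h⟩

theorem card_le_of_mem_run (past : List (Observation P)) {os : List (Observation P)}
    {D : Finset P} (hD : D ∈ A.run past os) : D.card ≤ k := by
  induction os generalizing past with
  | nil => simp [run] at hD
  | cons o os ih =>
    rcases List.mem_cons.1 hD with rfl | hD
    · exact A.card_serve_le _ _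
    · exact ih _ hD

end SemiOnlineAlgorithm

/-! ### Eviction cost against the heaviest missing page. -/

section Drift

variable {k : ℕ}

/-- The largest page that is missing from the cache. -/
def topHole (C : Finset (Fin (k + 1))) : ℕ := Cᶜ.sup Fin.val

/-- The page `p` has weight `2 ^ p`. -/
noncomputable def expWeight (k : ℕ) (p : Fin (k + 1)) : ℝ := 2 ^ p.val

theorem expWeight_nonneg (p : Fin (k + 1)) : 0 ≤ expWeight k p := by unfold expWeight; positivity

theorem le_topHole {C : Finset (Fin (k + 1))} {p : Fin (k + 1)} (hp : p ∉ C) :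
    p.val ≤ topHole C :=
  Finset.le_sup (f := Fin.val) (Finset.mem_compl.2 hp)

theorem topHole_le (C : Finset (Fin (k + 1))) : topHole C ≤ k :=
  Finset.sup_le fun p _ => by omega

theorem exists_notMem_val_eq_topHole {C : Finset (Fin (k + 1))} (hC : C.card ≤ k) :
    ∃ p, p ∉ C ∧ p.val = topHole C := by
  have hne : Cᶜ.Nonempty := by
    rw [← Finset.card_pos, Finset.card_compl, Fintype.card_fin]; omega
  obtain ⟨p, hp, h⟩ := Finset.exists_mem_eq_sup Cᶜ hne Fin.val
  exact ⟨p, Finset.mem_compl.1 hp, h.symm⟩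

theorem lastCache_mem {P : Type*} (C : Finset P) (S : List (Finset P)) : lastCache C S ∈ C :: S := by
  induction S generalizing C with
  | nil => exact List.mem_singleton.2 rfl
  | cons D S ih => exact List.mem_cons_of_mem _ (ih D)

/-- The final top hole is either a hole of `C` already or a page of `C` that was evicted. -/
theorem two_pow_topHole_lastCache_le {C : Finset (Fin (k + 1))} {S : List (Finset (Fin (k + 1)))}
    (hS : ∀ D ∈ C :: S, D.card ≤ k) :
    (2 : ℝ) ^ topHole (lastCache C S) ≤
      evictionCost (expWeight k) C S + 2 ^ topHole C := by
  obtain ⟨p, hp, hpe⟩ := exists_notMem_val_eq_topHole (hS _ (lastCache_mem C S))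
  have h0 := evictionCost_nonneg (expWeight_nonneg (k := k)) C S
  by_cases hC : p ∈ C
  · have := le_evictionCost expWeight_nonneg ⟨C, List.mem_cons_self, hC⟩ hp
    rw [expWeight, hpe] at this
    have : (0 : ℝ) < 2 ^ topHole C := by positivity
    linarith
  · have : (2 : ℝ) ^ topHole (lastCache C S) ≤ 2 ^ topHole C :=
      pow_le_pow_right₀ (by norm_num) (hpe ▸ le_topHole hC)
    linarith

/-- Every page has been in the cache at some time: those above the top hole of `C` at the start, the
others when requested. So the final top hole was evicted, and no allowance for `C` is needed. -/
theorem two_pow_topHole_lastCache_le_evictionCost {C : Finset (Fin (k + 1))}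
    {S : List (Finset (Fin (k + 1)))} (hS : ∀ D ∈ C :: S, D.card ≤ k)
    (hreq : ∀ p : Fin (k + 1), p.val ≤ topHole C → ∃ D ∈ S, p ∈ D) :
    (2 : ℝ) ^ topHole (lastCache C S) ≤ evictionCost (expWeight k) C S := by
  obtain ⟨p, hp, hpe⟩ := exists_notMem_val_eq_topHole (hS _ (lastCache_mem C S))
  rw [← hpe]
  refine le_evictionCost expWeight_nonneg ?_ hp
  by_cases hC : p ∈ C
  · exact ⟨C, List.mem_cons_self, hC⟩
  · obtain ⟨D, hD, h⟩ := hreq p (le_topHole hC)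
    exact ⟨D, List.mem_cons_of_mem _ hD, h⟩

end Drift


/-! ### The offline ski-rental recursion and its potential. -/

/-- The offline bookkeeping: `u n` is the normalised cost of the closed subintervals of the open
interval of level `n`, and `m n` is the number of further subintervals until buying pays off. -/
structure Ledger where
  u : ℕ → ℝ
  m : ℕ → ℕ

namespace Ledger

/-- The normalised cost at which the open interval of each level is closed. -/
noncomputable def closeCost (s : Ledger) : ℕ → ℝ
  | 0 => 1
  | n + 1 => min 1 (s.u (n + 1) + s.closeCost n / 2)

/-- Close the open intervals of levels at most `l`. -/
noncomputable def close (M : ℕ) (s : Ledger) (l : ℕ) : Ledger where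
  u i := if i ≤ l then 0 else if i = l + 1 then s.u (l + 1) + s.closeCost l / 2 else s.u i
  m i := if i ≤ l then M else if i = l + 1 then s.m (l + 1) - 1 else s.m i

/-- The ledger in which every interval has just been opened. -/
def init (M : ℕ) : Ledger where
  u _ := 0
  m _ := M

/-- An upper bound for the expected normalised cost of an interval with accumulated cost `t`, if
its subintervals cost `a` on average and `m` further ones remain until buying pays off. -/
noncomputable def value (a : ℝ) (m : ℕ) (t : ℝ) : ℝ :=
  t + a - (1 / 2) ^ m * (t + m * a / 2 + a - 1)

/-- The value of a fresh interval of each level. -/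
noncomputable def freshValue (M : ℕ) : ℕ → ℝ
  | 0 => 1
  | n + 1 => value (freshValue M n) M 0

/-- An upper bound for the expected normalised cost at which the open interval is closed. -/
noncomputable def potential (M : ℕ) (s : Ledger) : ℕ → ℝ
  | 0 => 1
  | n + 1 => value (freshValue M n) (s.m (n + 1)) (s.u (n + 1)) +
      (1 - (1 / 2) ^ s.m (n + 1)) / 2 * (potential M s n - freshValue M n)

theorem value_add_nonneg {a t q : ℝ} (ha : 0 ≤ a) (ht : 0 ≤ t) (hq : 0 ≤ q) (m : ℕ) :
    0 ≤ value a m t + (1 - (1 / 2) ^ m) / 2 * (q - a) := by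
  have h1 : ((1 : ℝ) / 2) ^ m ≤ 1 := pow_le_one₀ (by norm_num) (by norm_num)
  have h0 : (0 : ℝ) < (1 / 2) ^ m := by positivity
  have h2 : ((1 : ℝ) / 2) ^ m * (1 + m) ≤ 1 := by
    have : (1 : ℝ) + m ≤ 2 ^ m := by
      have := one_add_mul_le_pow (a := (1 : ℝ)) (by norm_num) m
      norm_num at this; linarith
    calc ((1 : ℝ) / 2) ^ m * (1 + m) ≤ (1 / 2) ^ m * 2 ^ m := by gcongr
      _ = 1 := by rw [← mul_pow]; norm_num
  have e : value a m t + (1 - (1 / 2) ^ m) / 2 * (q - a) =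
      t * (1 - (1 / 2) ^ m) + a * (1 - (1 / 2) ^ m * (1 + m)) / 2 + (1 / 2) ^ m +
        q * (1 - (1 / 2) ^ m) / 2 := by
    unfold value; ring
  rw [e]
  have := mul_nonneg ht (sub_nonneg.2 h1)
  have := mul_nonneg ha (sub_nonneg.2 h2)
  have := mul_nonneg hq (sub_nonneg.2 h1)
  linarith

theorem freshValue_nonneg (M n : ℕ) : 0 ≤ freshValue M n := by
  induction n with
  | zero => simp [freshValue]
  | succ n ih =>
    have := value_add_nonneg ih le_rfl ih M
    simpa [freshValue] using this

theorem potential_nonneg (M : ℕ) (s : Ledger) (hs : ∀ i, 0 ≤ s.u i) (n : ℕ) :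
    0 ≤ potential M s n := by
  induction n with
  | zero => simp [potential]
  | succ n ih => exact value_add_nonneg (freshValue_nonneg M n) (hs _) ih _

theorem closeCost_nonneg (s : Ledger) (hs : ∀ i, 0 ≤ s.u i) (n : ℕ) : 0 ≤ s.closeCost n := by
  induction n with
  | zero => simp [closeCost]
  | succ n ih => exact le_min zero_le_one (by have := hs (n + 1); positivity)

theorem close_u_nonneg (M : ℕ) (s : Ledger) (hs : ∀ i, 0 ≤ s.u i) (l i : ℕ) :
    0 ≤ (s.close M l).u i := by
  have := closeCost_nonneg s hs l
  have := hs (l + 1)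
  simp only [close]
  split_ifs
  · rfl
  · positivity
  · exact hs i

theorem potential_close_of_le (M : ℕ) (s : Ledger) {n l : ℕ} (h : n ≤ l) :
    potential M (s.close M l) n = freshValue M n := by
  induction n with
  | zero => simp [potential, freshValue]
  | succ n ih =>
    rw [potential, ih (by omega)]
    simp [close, h, freshValue]

/-- One ski-rental round: when a subinterval of cost `x` closes, the enclosing interval stays open
or closes with it, each with probability `1 / 2`. For `m = 0` the purchase is due and the minimum is
bounded by `1`; otherwise it is bounded by the rent. -/
theorem value_add_min_le (a t x : ℝ) (m : ℕ) :
    value a (m - 1) (t + x / 2) + min 1 (t + x / 2) ≤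
      2 * (value a m t + (1 - (1 / 2) ^ m) / 2 * (x - a)) := by
  cases m with
  | zero =>
    have := min_le_left 1 (t + x / 2)
    simp [value]; linarith
  | succ m =>
    have := min_le_right 1 (t + x / 2)
    simp only [value, Nat.add_sub_cancel, pow_succ]
    push_cast
    linarith

theorem sum_half_pow (n : ℕ) : ∑ l ∈ Finset.range n, ((1 : ℝ) / 2) ^ (l + 1) = 1 - (1 / 2) ^ n := by
  induction n with
  | zero => simp
  | succ n ih => rw [Finset.sum_range_succ, ih, pow_succ]; ring

/-- The supermartingale property: a step of level `l < n` leaves the level-`n` interval open, and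
with probability `2⁻ⁿ` the step closes it at `closeCost n`. In the induction, levels below `n`
change only the term for the open subinterval, and level `n` itself is one ski-rental round. -/
theorem sum_potential_close_le (M : ℕ) (s : Ledger) (n : ℕ) :
    ∑ l ∈ Finset.range n, (1 / 2) ^ (l + 1) * potential M (s.close M l) n +
      (1 / 2) ^ n * s.closeCost n ≤ potential M s n := by
  induction n with
  | zero => simp [closeCost, potential]
  | succ n ih =>
    set a := freshValue M n with ha
    set t := s.u (n + 1) with ht
    set m := s.m (n + 1) with hm
    set x := s.closeCost n with hx
    have h1 : ∀ l ∈ Finset.range n,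
        ((1 : ℝ) / 2) ^ (l + 1) * potential M (s.close M l) (n + 1) =
          (1 / 2) ^ (l + 1) * (value a m t - (1 - (1 / 2) ^ m) / 2 * a) +
            (1 - (1 / 2) ^ m) / 2 * ((1 / 2) ^ (l + 1) * potential M (s.close M l) n) := by
      intro l hl
      have hl := Finset.mem_range.1 hl
      have e1 : (s.close M l).u (n + 1) = t := by
        simp [close, ht, show ¬ n + 1 ≤ l by omega, show n ≠ l by omega]
      have e2 : (s.close M l).m (n + 1) = m := by
        simp [close, hm, show ¬ n + 1 ≤ l by omega, show n ≠ l by omega]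
      rw [potential, e1, e2, ← ha]; ring
    have h2 : potential M (s.close M n) (n + 1) = value a (m - 1) (t + x / 2) := by
      rw [potential, potential_close_of_le M s le_rfl]
      simp [close, ← ha, ← hm, ← ht, ← hx]
    rw [Finset.sum_range_succ, Finset.sum_congr rfl h1, Finset.sum_add_distrib, ← Finset.sum_mul,
      ← Finset.mul_sum, sum_half_pow, h2, closeCost, potential, ← ha, ← hm, ← ht, ← hx]
    have h3 := value_add_min_le a t x m
    have h4 : ((1 : ℝ) / 2) ^ m ≤ 1 := pow_le_one₀ (by norm_num) (by norm_num)
    have h5 := mul_le_mul_of_nonneg_left ih (show (0 : ℝ) ≤ (1 - (1 / 2) ^ m) / 2 by linarith)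
    have h6 := mul_le_mul_of_nonneg_left h3 (show (0 : ℝ) ≤ (1 / 2) ^ (n + 1) by positivity)
    rw [pow_succ] at h6 ⊢
    linarith

end Ledger

/-! ### Averaging over the truncated geometric level. -/

/-- The average of `f` with respect to the geometric distribution on `{0, …, n}` truncated at `n`. -/
noncomputable def geomAvg (n : ℕ) (f : ℕ → ℝ) : ℝ :=
  ∑ l ∈ Finset.range n, (1 / 2) ^ (l + 1) * f l + (1 / 2) ^ n * f n

theorem geomAvg_mono {n : ℕ} {f g : ℕ → ℝ} (h : ∀ l ≤ n, f l ≤ g l) :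
    geomAvg n f ≤ geomAvg n g := by
  unfold geomAvg
  gcongr with l hl
  · exact h l (Finset.mem_range.1 hl).le
  · exact h n le_rfl

theorem geomAvg_const (n : ℕ) (c : ℝ) : geomAvg n (fun _ => c) = c := by
  unfold geomAvg; rw [← Finset.sum_mul, Ledger.sum_half_pow]; ring

theorem geomAvg_sub (n : ℕ) (f g : ℕ → ℝ) :
    geomAvg n (fun l => f l - g l) = geomAvg n f - geomAvg n g := by
  unfold geomAvg; simp only [mul_sub, Finset.sum_sub_distrib]; ring

theorem geomAvg_add (n : ℕ) (f g : ℕ → ℝ) :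
    geomAvg n (fun l => f l + g l) = geomAvg n f + geomAvg n g := by
  unfold geomAvg; simp only [mul_add, Finset.sum_add_distrib]; ring

theorem geomAvg_mul_left (n : ℕ) (c : ℝ) (f : ℕ → ℝ) :
    geomAvg n (fun l => c * f l) = c * geomAvg n f := by
  unfold geomAvg; rw [mul_add, Finset.mul_sum]
  congr 1
  · exact Finset.sum_congr rfl fun _ _ => by ring
  · ring

theorem exists_le_of_geomAvg_le {n : ℕ} {f : ℕ → ℝ} {c : ℝ} (h : c ≤ geomAvg n f) :
    ∃ l ≤ n, c ≤ f l := by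
  by_contra! H
  have : geomAvg n f < geomAvg n (fun _ => c) := by
    unfold geomAvg
    refine add_lt_add_of_le_of_lt (Finset.sum_le_sum fun l hl => ?_) ?_
    · have := H l (Finset.mem_range.1 hl).le
      gcongr
    · have := H n le_rfl
      gcongr
  rw [geomAvg_const] at this
  linarith

theorem geomAvg_tail {n j : ℕ} (hj : j ≤ n) (c : ℝ) :
    geomAvg n (fun l => if j ≤ l then c else 0) = (1 / 2) ^ j * c := by
  induction n, hj using Nat.le_induction with
  | base =>
    unfold geomAvg
    rw [Finset.sum_eq_zero fun l hl => by simp [Nat.not_le.2 (Finset.mem_range.1 hl)]]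
    simp
  | succ n hn ih =>
    rw [← ih]; unfold geomAvg
    rw [Finset.sum_range_succ]
    simp only [hn, Nat.le_succ_of_le hn, if_true, pow_succ]; ring

theorem geomAvg_ledger_le (M n : ℕ) (s : Ledger) :
    geomAvg n (fun l => (s.close M l).u (n + 1) + Ledger.potential M (s.close M l) n / 2) ≤
      s.u (n + 1) + Ledger.potential M s n / 2 + (1 / 2) ^ n * (Ledger.freshValue M n / 2) := by
  have h := Ledger.sum_potential_close_le M s n
  have e : ∀ l ∈ Finset.range n, ((1 : ℝ) / 2) ^ (l + 1) *
      ((s.close M l).u (n + 1) + Ledger.potential M (s.close M l) n / 2) =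
      (1 / 2) ^ (l + 1) * s.u (n + 1) +
        (1 / 2) ^ (l + 1) * Ledger.potential M (s.close M l) n / 2 := by
    intro l hl
    have hl := Finset.mem_range.1 hl
    have e1 : (s.close M l).u (n + 1) = s.u (n + 1) := by
      simp [Ledger.close, show ¬ n + 1 ≤ l by omega, show n ≠ l by omega]
    rw [e1]; ring
  have e2 : (s.close M n).u (n + 1) = s.u (n + 1) + s.closeCost n / 2 := by simp [Ledger.close]
  unfold geomAvg
  rw [Finset.sum_congr rfl e, Finset.sum_add_distrib, ← Finset.sum_mul, ← Finset.sum_div,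
    Ledger.sum_half_pow]
  beta_reduce
  rw [e2, Ledger.potential_close_of_le M s le_rfl]
  linarith

/-! ### Decay of the fresh value with the level. -/

namespace Ledger

/-- The recursion is affine in the previous fresh value, with fixed point `2 / (M + 2)`. -/
theorem freshValue_sub (M n : ℕ) : freshValue M n - 2 / (M + 2) =
    (1 - (1 / 2) ^ M * ((M + 2) / 2)) ^ n * (1 - 2 / (M + 2)) := by
  induction n with
  | zero => simp [freshValue]
  | succ n ih =>
    rw [pow_succ, mul_right_comm, ← ih, freshValue, value]
    have : (M : ℝ) + 2 ≠ 0 := by positivity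
    field_simp
    ring

theorem freshValue_le {M n : ℕ} (h : 2 ^ M ≤ n ∨ M = 0) : freshValue M n ≤ 4 / (M + 2) := by
  have h0 := freshValue_sub M n
  rcases h with h | rfl
  · have hM : (0 : ℝ) < M + 2 := by positivity
    have hθ : ((1 : ℝ) / 2) ^ M * ((M + 2) / 2) ≤ 1 := by
      have : ((M : ℝ) + 2) / 2 ≤ 2 ^ M := by
        have := one_add_mul_le_pow (a := (1 : ℝ)) (by norm_num) M
        norm_num at this
        have h3 : (0 : ℝ) ≤ M := by positivity
        linarith
      calc ((1 : ℝ) / 2) ^ M * ((M + 2) / 2) ≤ (1 / 2) ^ M * 2 ^ M := by gcongr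
        _ = 1 := by rw [← mul_pow]; norm_num
    set θ := ((1 : ℝ) / 2) ^ M * ((M + 2) / 2) with hθd
    have hθ0 : 0 < θ := by positivity
    -- With `2 ^ M` levels the contraction `(1 - θ) ^ n ≤ exp (-n θ)` brings the value within `2 /
    -- (M + 2)` of the fixed point.
    have h1 : (M + 2 : ℝ) / 2 ≤ n * θ := by
      have : (2 : ℝ) ^ M ≤ n := by exact_mod_cast h
      calc (M + 2 : ℝ) / 2 = 2 ^ M * θ := by
            rw [hθd, ← mul_assoc, ← mul_pow]; norm_num
        _ ≤ n * θ := by gcongr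
    have h2 : (1 - θ) ^ n ≤ 2 / (M + 2) := by
      have h3 : (1 - θ) ^ n ≤ Real.exp (-(n * θ)) := by
        have := Real.add_one_le_exp (-θ)
        calc (1 - θ) ^ n ≤ Real.exp (-θ) ^ n := by
              apply pow_le_pow_left₀ <;> linarith
          _ = _ := by rw [← Real.exp_nat_mul]; ring_nf
      have h4 : Real.exp (-(n * θ)) ≤ Real.exp (-((M + 2) / 2)) := Real.exp_le_exp.2 (by linarith)
      have h5 : Real.exp (-((M + 2 : ℝ) / 2)) ≤ ((M + 2 : ℝ) / 2)⁻¹ := by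
        rw [Real.exp_neg]
        have := Real.add_one_le_exp ((M + 2 : ℝ) / 2)
        gcongr; linarith
      rw [inv_div] at h5
      linarith
    have h3 : (1 - θ) ^ n * (1 - 2 / ((M : ℝ) + 2)) ≤ (1 - θ) ^ n := by
      have h6 : (0 : ℝ) ≤ (1 - θ) ^ n := pow_nonneg (by linarith) n
      have h7 : (0 : ℝ) < 2 / ((M : ℝ) + 2) := by positivity
      nlinarith
    have : (4 : ℝ) / (M + 2) = 2 / (M + 2) + 2 / (M + 2) := by ring
    linarith
  · norm_num at h0 ⊢; linarith

end Ledger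


/-! ### Solutions realising the ledger. -/

section Offline

variable {k : ℕ}

/-- The requests made during the steps at the given levels. -/
noncomputable def steps (k : ℕ) : (ℕ → ℝ) → List ℕ → List (Request (Fin (k + 1)))
  | _, [] => []
  | t, l :: ls => step k t l ++ steps k (reschedule t l) ls

theorem gen_eq_steps_append (t : ℕ → ℝ) (ls : List ℕ) :
    gen k t ls = steps k t ls ++ block k (ls.foldl reschedule t) 0 (k + 1) := by
  induction ls generalizing t with
  | nil => rfl
  | cons l ls ih => simp only [gen, steps, ih, List.append_assoc, List.foldl_cons]

theorem steps_append_singleton (t : ℕ → ℝ) (ls : List ℕ) (l : ℕ) :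
    steps k t (ls ++ [l]) = steps k t ls ++ step k (ls.foldl reschedule t) l := by
  induction ls generalizing t with
  | nil => simp [steps]
  | cons i ls ih => simp only [List.cons_append, steps, ih, List.append_assoc, List.foldl_cons]

/-- Some solution leads from the cache missing only `h` to the cache missing only `h'` at cost at
most `x`. -/
def Serves (σ : List (Request (Fin (k + 1)))) (h h' : Fin (k + 1)) (x : ℝ) : Prop :=
  ∃ S, IsSolution k σ S ∧ lastCache {h}ᶜ S = {h'}ᶜ ∧ cost (expWeight k) {h}ᶜ S ≤ x

theorem Serves.mono {σ : List (Request (Fin (k + 1)))} {h h' : Fin (k + 1)} {x y : ℝ}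
    (H : Serves σ h h' x) (hxy : x ≤ y) : Serves σ h h' y := by
  obtain ⟨S, h1, h2, h3⟩ := H
  exact ⟨S, h1, h2, h3.trans hxy⟩

theorem Serves.append {σ τ : List (Request (Fin (k + 1)))} {h h' h'' : Fin (k + 1)} {x y : ℝ}
    (H : Serves σ h h' x) (H' : Serves τ h' h'' y) : Serves (σ ++ τ) h h'' (x + y) := by
  obtain ⟨S, h1, h2, h3⟩ := H
  obtain ⟨S', h1', h2', h3'⟩ := H'
  refine ⟨S ++ S', List.rel_append h1 h1', ?_, ?_⟩
  · rw [lastCache_append, h2, h2']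
  · rw [cost_append, h2]; linarith

theorem Serves.stay {σ : List (Request (Fin (k + 1)))} {h : Fin (k + 1)}
    (hσ : ∀ r ∈ σ, r.page ≠ h) : Serves σ h h 0 := by
  induction σ with
  | nil => exact ⟨[], List.Forall₂.nil, rfl, le_rfl⟩
  | cons r σ ih =>
    obtain ⟨S, h1, h2, h3⟩ := ih fun r hr => hσ r (List.mem_cons_of_mem _ hr)
    refine ⟨{h}ᶜ :: S, List.Forall₂.cons ⟨?_, ?_⟩ h1, h2, ?_⟩
    · simpa using hσ r List.mem_cons_self
    · simp [Finset.card_compl]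
    · simpa [cost] using h3

theorem Serves.move {σ : List (Request (Fin (k + 1)))} (hne : σ ≠ []) {h h' : Fin (k + 1)}
    (hσ : ∀ r ∈ σ, r.page ≠ h') : Serves σ h h' (expWeight k h) := by
  obtain ⟨r, τ, rfl⟩ := List.exists_cons_of_ne_nil hne
  obtain ⟨S, h1, h2, h3⟩ := Serves.stay fun r hr => hσ r (List.mem_cons_of_mem _ hr)
  refine ⟨{h'}ᶜ :: S, List.Forall₂.cons ⟨?_, ?_⟩ h1, h2, ?_⟩
  · simpa using hσ r List.mem_cons_self
  · simp [Finset.card_compl]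
  · have : ∑ p ∈ ({h'}ᶜ : Finset (Fin (k + 1))) \ {h}ᶜ, expWeight k p ≤
        ∑ p ∈ {h}, expWeight k p := by
      refine Finset.sum_le_sum_of_subset_of_nonneg (fun p hp => ?_) fun p _ _ => expWeight_nonneg p
      simp at hp; simpa using hp.2
    rw [Finset.sum_singleton] at this
    rw [cost]; linarith

theorem page_ne_of_mem_block {t : ℕ → ℝ} {a n : ℕ} (hn : a + n ≤ k + 1) {r : Request (Fin (k + 1))}
    (hr : r ∈ block k t a n) {p : Fin (k + 1)} (hp : p.val < a ∨ a + n ≤ p.val) : r.page ≠ p := by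
  obtain ⟨i, hi, rfl⟩ := mem_block.1 hr
  intro h
  have h1 : (Fin.ofNat (k + 1) i).val = i := Nat.mod_eq_of_lt (by omega)
  have h2 := congrArg Fin.val h
  dsimp only at h2
  omega

theorem block_ne_nil {t : ℕ → ℝ} {a n : ℕ} (hn : n ≠ 0) : block k t a n ≠ [] := by
  simpa [block] using hn

theorem page_ne_of_mem_step {t : ℕ → ℝ} {l : ℕ} (hl : l < k) {p : Fin (k + 1)}
    (hp : l + 1 < p.val) {r : Request (Fin (k + 1))} (hr : r ∈ step k t l) : r.page ≠ p := by
  have h0 : (0 : Fin (k + 1)) ≠ p := fun h => by subst h; simp at hp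
  simp only [step, List.mem_cons] at hr
  rcases hr with rfl | rfl | hr
  · exact h0
  · exact h0
  · exact page_ne_of_mem_block (by omega) hr (Or.inr (by omega))

theorem step_eq_append (t : ℕ → ℝ) (l : ℕ) :
    step k t l = [⟨0, t 0⟩, ⟨0, (t 0 + t 1) / 2⟩] ++ block k t 1 (l + 1) := rfl

theorem serves_step_to_zero (t : ℕ → ℝ) {l : ℕ} (hl : l < k) {j : Fin (k + 1)} (hj : j ≠ 0) :
    Serves (step k t l) j 0 (2 ^ j.val) := by
  rw [step_eq_append]
  have h1 : Serves [⟨0, t 0⟩, ⟨0, (t 0 + t 1) / 2⟩] j j 0 := Serves.stay (by simp [hj.symm])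
  have h2 : Serves (block k t 1 (l + 1)) j 0 (expWeight k j) :=
    Serves.move (block_ne_nil (by omega)) fun r hr =>
      page_ne_of_mem_block (by omega) hr (Or.inl (by simp))
  exact (h1.append h2).mono (by simp [expWeight])

theorem serves_step_zero_zero (t : ℕ → ℝ) {l : ℕ} (hl : l < k) {j : Fin (k + 1)} (hj : j ≠ 0) :
    Serves (step k t l) 0 0 (1 + 2 ^ j.val) := by
  rw [step_eq_append]
  have h1 : Serves [⟨0, t 0⟩, ⟨0, (t 0 + t 1) / 2⟩] 0 j (expWeight k 0) :=
    Serves.move (by simp) (by simp [hj.symm])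
  have h2 : Serves (block k t 1 (l + 1)) j 0 (expWeight k j) :=
    Serves.move (block_ne_nil (by omega)) fun r hr =>
      page_ne_of_mem_block (by omega) hr (Or.inl (by simp))
  exact (h1.append h2).mono (by simp [expWeight])

/-- The cost of the closed intervals of level at least `j` that the ledger records. -/
noncomputable def Ledger.paid (k : ℕ) (s : Ledger) (j : ℕ) : ℝ :=
  ∑ i ∈ Finset.Icc j k, 2 ^ (i + 2) * s.u i

theorem Ledger.paid_eq_add (s : Ledger) {j : ℕ} (hj : j ≤ k) :
    s.paid k j = 2 ^ (j + 2) * s.u j + s.paid k (j + 1) := by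
  unfold Ledger.paid
  rw [← Finset.insert_Icc_add_one_left_eq_Icc hj, Finset.sum_insert (by simp)]

theorem Ledger.paid_close_of_lt (M : ℕ) (s : Ledger) {l j : ℕ} (hj : l + 1 < j) :
    (s.close M l).paid k j = s.paid k j := by
  refine Finset.sum_congr rfl fun i hi => ?_
  have := (Finset.mem_Icc.1 hi).1
  rw [Ledger.close]
  simp only [show ¬ i ≤ l by omega, show i ≠ l + 1 by omega, if_false]

theorem Ledger.paid_close_of_le (M : ℕ) (s : Ledger) {l j : ℕ} (hl : l < k) (hj : j ≤ l + 1) :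
    (s.close M l).paid k j = s.paid k (l + 1) + 2 ^ (l + 2) * s.closeCost l := by
  induction hj using Nat.decreasingInduction with
  | self =>
    rw [Ledger.paid_eq_add _ (by omega), Ledger.paid_eq_add s (by omega : l + 1 ≤ k),
      Ledger.paid_close_of_lt M s (by omega)]
    simp [Ledger.close]; ring
  | of_succ j hj ih =>
    rw [Ledger.paid_eq_add _ (by omega), ih]
    simp [Ledger.close, show j ≤ l by omega]

/-- The ledger after the steps at the given levels. -/
noncomputable def ledger (M : ℕ) (ls : List ℕ) : Ledger := ls.foldl (Ledger.close M) (Ledger.init M)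

theorem ledger_append_singleton (M : ℕ) (ls : List ℕ) (l : ℕ) :
    ledger M (ls ++ [l]) = (ledger M ls).close M l := by simp [ledger]

theorem ledger_u_nonneg (M : ℕ) (ls : List ℕ) (i : ℕ) : 0 ≤ (ledger M ls).u i := by
  induction ls using List.reverseRecOn generalizing i with
  | nil => exact le_rfl
  | append_singleton ls l ih =>
    rw [ledger_append_singleton]; exact Ledger.close_u_nonneg M _ ih l i

/-- Page `j` is not requested within the open interval of level `j - 1`. So either that interval has
had no step yet and the hole is at `0`, or the hole waits at `j`, the extra `1` paying for page `0`.
-/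
theorem serves_steps (M : ℕ) (t : ℕ → ℝ) {ls : List ℕ} (hls : ∀ l ∈ ls, l < k)
    (j : Fin (k + 1)) (hj : j ≠ 0) :
    Serves (steps k t ls) 0 0 ((ledger M ls).paid k j.val) ∨
      Serves (steps k t ls) 0 j ((ledger M ls).paid k j.val + 1) := by
  induction ls using List.reverseRecOn generalizing j with
  | nil =>
    refine Or.inl ((Serves.stay (by simp [steps])).mono ?_)
    exact Finset.sum_nonneg fun i _ => mul_nonneg (by positivity) (ledger_u_nonneg M [] i)
  | append_singleton ls l ih =>
    have hl : l < k := hls l (by simp)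
    have ih := ih fun i hi => hls i (List.mem_append_left _ hi)
    rw [ledger_append_singleton, steps_append_singleton]
    set s := ledger M ls
    set t' := ls.foldl reschedule t
    by_cases hlj : l + 1 < j.val
    · right
      rw [Ledger.paid_close_of_lt M s hlj]
      have hne := fun r hr => page_ne_of_mem_step (t := t') (r := r) hl hlj hr
      rcases ih j hj with h | h
      · exact (h.append (Serves.move (by simp [step]) hne)).mono (by simp [expWeight])
      · exact (h.append (Serves.stay hne)).mono (by simp)
    · left
      -- Buying on level `n`: the hole is kept at page `n + 1`, at cost `1` for page `0` plus `2 ^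
      -- (n + 1)` for returning.
      have hbuy : ∀ n (hn : n < k), Serves (steps k t ls ++ step k t' l) 0 0
          (s.paid k (n + 1) + 2 ^ (n + 2)) := by
        intro n hn
        have hj0 : (⟨n + 1, by omega⟩ : Fin (k + 1)) ≠ 0 := fun h => by
          simpa using congrArg Fin.val h
        have h1 : (1 : ℝ) ≤ 2 ^ (n + 1) := one_le_pow₀ (by norm_num)
        have h2 : (2 : ℝ) ^ (n + 2) = 2 ^ (n + 1) + 2 ^ (n + 1) := by ring
        rcases ih _ hj0 with h | h
        · refine (h.append (serves_step_zero_zero t' hl hj0)).mono ?_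
          dsimp only; linarith
        · refine (h.append (serves_step_to_zero t' hl hj0)).mono ?_
          dsimp only; linarith
      have key : ∀ n (hn : n < k), Serves (steps k t ls ++ step k t' l) 0 0
          (s.paid k (n + 1) + 2 ^ (n + 2) * s.closeCost n) := by
        -- The minimum in `closeCost` chooses between buying and the solution already found one
        -- level below.
        intro n
        induction n with
        | zero => intro hn; simpa [Ledger.closeCost] using hbuy 0 hn
        | succ n ihn =>
          intro hn
          rw [Ledger.closeCost]
          rcases min_choice 1 (s.u (n + 1) + s.closeCost n / 2) with h | h
          · rw [h, mul_one]; exact hbuy _ hn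
          · rw [h]
            refine (ihn (by omega)).mono (le_of_eq ?_)
            rw [Ledger.paid_eq_add s (by omega : n + 1 ≤ k)]; ring
      rw [Ledger.paid_close_of_le M s hl (by omega)]
      exact key l hl

theorem optCost_nonneg (C : Finset (Fin (k + 1))) (σ : List (Request (Fin (k + 1)))) :
    0 ≤ optCost k (expWeight k) C σ := by
  refine Real.sInf_nonneg ?_
  rintro x ⟨S, -, rfl⟩
  exact cost_nonneg expWeight_nonneg _ _

theorem Serves.optCost_le {σ : List (Request (Fin (k + 1)))} {h h' : Fin (k + 1)} {x : ℝ}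
    (H : Serves σ h h' x) (C : Finset (Fin (k + 1))) :
    optCost k (expWeight k) C σ ≤ x + ∑ p, expWeight k p := by
  obtain ⟨S, h1, -, h3⟩ := H
  have hle : cost (expWeight k) C S ≤ cost (expWeight k) {h}ᶜ S + ∑ p, expWeight k p := by
    have hW : ∀ D : Finset (Fin (k + 1)), ∑ p ∈ D, expWeight k p ≤ ∑ p, expWeight k p := fun D =>
      Finset.sum_le_sum_of_subset_of_nonneg (Finset.subset_univ D) fun p _ _ => expWeight_nonneg p
    cases S with
    | nil => simpa [cost] using hW ∅
    | cons D S =>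
      have := hW (D \ C)
      have : 0 ≤ ∑ p ∈ D \ {h}ᶜ, expWeight k p := Finset.sum_nonneg fun p _ => expWeight_nonneg p
      simp only [cost]; linarith
  have hbdd : BddBelow {x : ℝ | ∃ S, IsSolution k σ S ∧ x = cost (expWeight k) C S} :=
    ⟨0, by rintro y ⟨S', -, rfl⟩; exact cost_nonneg expWeight_nonneg _ _⟩
  exact (csInf_le hbdd ⟨S, h1, rfl⟩).trans (by linarith)

theorem optCost_gen_le (hk : 1 ≤ k) (M : ℕ) (t : ℕ → ℝ) {ls : List ℕ} (hls : ∀ l ∈ ls, l < k)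
    (C : Finset (Fin (k + 1))) :
    optCost k (expWeight k) C (gen k t ls) ≤
      2 ^ (k + 2) * (ledger M ls).u k + (2 ^ k + 4 + ∑ p, expWeight k p) := by
  have hfinal : ∀ h, Serves (block k (ls.foldl reschedule t) 0 (k + 1)) h 0
      (expWeight k h + 2) := by
    intro h
    set t' := ls.foldl reschedule t
    have e : block k t' 0 (k + 1) = [⟨0, t' 0⟩] ++ block k t' 1 k := by
      simp [block, List.range'_succ]
    have hne : (0 : Fin (k + 1)) ≠ ⟨1, by omega⟩ := fun h => by simpa using congrArg Fin.val h
    have h1 : Serves [⟨0, t' 0⟩] h ⟨1, by omega⟩ (expWeight k h) :=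
      Serves.move (by simp) (by simp [hne])
    have h2 : Serves (block k t' 1 k) ⟨1, by omega⟩ 0 (expWeight k ⟨1, by omega⟩) :=
      Serves.move (block_ne_nil (by omega)) fun r hr =>
        page_ne_of_mem_block (by omega) hr (Or.inl (by simp))
    rw [e]
    exact (h1.append h2).mono (by simp [expWeight])
  have hk0 : Fin.last k ≠ 0 := fun h => by
    have := congrArg Fin.val h
    simp at this; omega
  have hpaid : (ledger M ls).paid k (Fin.last k).val = 2 ^ (k + 2) * (ledger M ls).u k := by
    simp [Ledger.paid]
  have h2k : (1 : ℝ) ≤ 2 ^ k := one_le_pow₀ (by norm_num)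
  rw [gen_eq_steps_append]
  rcases serves_steps M t hls (Fin.last k) hk0 with h | h
  · refine ((h.append (hfinal _)).optCost_le C).trans ?_
    rw [hpaid]; simp [expWeight]; linarith
  · refine ((h.append (hfinal _)).optCost_le C).trans ?_
    rw [hpaid]; simp [expWeight]; linarith

end Offline

/-! ### The online gain per step. -/

section Progress

variable {k : ℕ}

/-- The eviction cost incurred during the steps at the given levels, minus the weight of the
heaviest page missing from the cache at the end. -/
noncomputable def progress (A : SemiOnlineAlgorithm k (Fin (k + 1))) (C : Finset (Fin (k + 1)))
    (t : ℕ → ℝ) (ls : List ℕ) : ℝ :=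
  evictionCost (expWeight k) C (A.run [] (history k t ls)) -
    2 ^ topHole (lastCache C (A.run [] (history k t ls)))

theorem progress_add_two_le {n : ℕ} (hn : k = n + 1) (A : SemiOnlineAlgorithm k (Fin (k + 1)))
    {C : Finset (Fin (k + 1))} (hC : C.card ≤ k) (t : ℕ → ℝ) (ls : List ℕ) :
    progress A C t ls + 2 ≤ geomAvg n fun l => progress A C t (ls ++ [l]) := by
  set S := A.run [] (history k t ls) with hS
  set D := lastCache C S with hD
  set t' := ls.foldl reschedule t with ht'
  set o := firstObservation k t' with ho
  set E := A.serve (history k t ls) o with hE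
  have hDk : D.card ≤ k := by
    rcases List.mem_cons.1 (lastCache_mem C S) with h | h
    · rwa [hD, h]
    · exact A.card_le_of_mem_run _ h
  have hEk : E.card ≤ k := A.card_serve_le _ _
  have hE0 : (0 : Fin (k + 1)) ∈ E := A.page_mem_serve _ o
  have hpos : 1 ≤ topHole E := by
    obtain ⟨p, hp, hpe⟩ := exists_notMem_val_eq_topHole hEk
    have : p.val ≠ 0 := fun h => hp (by rwa [show p = 0 from Fin.ext h])
    omega
  have hDE := two_pow_topHole_lastCache_le (C := D) (S := [E]) (by simp [hDk, hEk])
  simp only [lastCache] at hDE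
  have hprog : ∀ l, progress A C t (ls ++ [l]) = evictionCost (expWeight k) C S +
      evictionCost (expWeight k) D [E] +
      evictionCost (expWeight k) E (A.run (history k t ls ++ [o]) (laterObservations k t' l)) -
      2 ^ topHole (lastCache E (A.run (history k t ls ++ [o]) (laterObservations k t' l))) := by
    intro l
    rw [progress, history_append_singleton, A.run_append, evictionCost_append, lastCache_append,
      ← hS, ← hD, ← ht', ← ho, List.nil_append, SemiOnlineAlgorithm.run, ← hE]
    simp only [evictionCost, lastCache]
    ring
  -- `E` is chosen before `l` matters; the step requests every page up to `topHole E` once `l + 1`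
  -- reaches it.
  have hgain : ∀ l, progress A C t ls + (if topHole E - 1 ≤ l then 2 ^ topHole E else 0) ≤
      progress A C t (ls ++ [l]) := by
    intro l
    have hcard : ∀ F ∈ E :: A.run (history k t ls ++ [o]) (laterObservations k t' l),
        F.card ≤ k := by
      intro F hF
      rcases List.mem_cons.1 hF with rfl | hF
      · exact hEk
      · exact A.card_le_of_mem_run _ hF
    have hcur : progress A C t ls = evictionCost (expWeight k) C S - 2 ^ topHole D := rfl
    rw [hprog l, hcur]
    split_ifs with hl
    · have := two_pow_topHole_lastCache_le_evictionCost hcard fun p hp => by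
        obtain ⟨o', ho', rfl⟩ := exists_mem_laterObservations t' (l := l) (p := p) (by omega)
        exact A.exists_page_mem_run _ ho'
      linarith
    · have := two_pow_topHole_lastCache_le hcard
      linarith
  refine le_trans (le_of_eq ?_) (geomAvg_mono fun l _ => hgain l)
  rw [geomAvg_add, geomAvg_const, geomAvg_tail (by have := topHole_le E; omega)]
  obtain ⟨j, hj⟩ := Nat.exists_eq_add_of_le' hpos
  rw [hj, Nat.add_sub_cancel, pow_succ, ← mul_assoc, ← mul_pow]
  norm_num

theorem progress_le_cost (A : SemiOnlineAlgorithm k (Fin (k + 1))) (C : Finset (Fin (k + 1)))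
    (t : ℕ → ℝ) {ls : List ℕ} (hls : ∀ l ∈ ls, l < k) :
    progress A C t ls ≤ cost (expWeight k) C (A.solution (gen k t ls)) + ∑ p, expWeight k p := by
  rw [SemiOnlineAlgorithm.solution, observations_gen t hls, A.run_append, cost_append, progress]
  set S := A.run [] (history k t ls)
  have h1 := evictionCost_add_sum (expWeight k) C S
  have h2 : (0 : ℝ) < 2 ^ topHole (lastCache C S) := by positivity
  have h3 : 0 ≤ ∑ p ∈ lastCache C S, expWeight k p := Finset.sum_nonneg fun p _ => expWeight_nonneg p
  have h4 : ∑ p ∈ C, expWeight k p ≤ ∑ p, expWeight k p :=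
    Finset.sum_le_sum_of_subset_of_nonneg (Finset.subset_univ C) fun p _ _ => expWeight_nonneg p
  have h5 := cost_nonneg (expWeight_nonneg (k := k)) (lastCache C S)
    (A.run ([] ++ history k t ls) (observations (gen k (ls.foldl reschedule t) [])))
  linarith

end Progress

/-! ### Integrability of the costs. -/

section Measure

variable {k : ℕ} {P Ω : Type*} [MeasurableSpace Ω]

theorem RandomizedSemiOnlineAlgorithm.measurableSet_run_eq
    (A : RandomizedSemiOnlineAlgorithm k P Ω) (past os : List (Observation P))
    (S : List (Finset P)) : MeasurableSet {ω | (A.toFun ω).run past os = S} := by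
  induction os generalizing past S with
  | nil => simp only [SemiOnlineAlgorithm.run]; exact MeasurableSet.const _
  | cons o os ih =>
    cases S with
    | nil => simp [SemiOnlineAlgorithm.run]
    | cons D S =>
      simp only [SemiOnlineAlgorithm.run, List.cons.injEq]
      exact (A.measurableSet_serve_eq past o D).inter (ih _ S)

theorem RandomizedSemiOnlineAlgorithm.integrable_run [Finite P]
    (A : RandomizedSemiOnlineAlgorithm k P Ω) (μ : Measure Ω) [IsFiniteMeasure μ]
    (past os : List (Observation P)) (f : List (Finset P) → ℝ) :
    Integrable (fun ω => f ((A.toFun ω).run past os)) μ := by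
  cases nonempty_fintype P
  let _ : MeasurableSpace (List (Finset P)) := ⊤
  have hm : Measurable fun ω => (A.toFun ω).run past os :=
    measurable_to_countable' fun S => A.measurableSet_run_eq past os S
  have hf : Measurable f := measurable_from_top
  have hfin : (f '' {S | S.length = os.length}).Finite :=
    (List.finite_length_eq (Finset P) os.length).image f
  obtain ⟨b, hb⟩ := hfin.isBounded.exists_norm_le
  refine Integrable.of_bound (hf.comp hm).aestronglyMeasurable b (ae_of_all _ fun ω => ?_)
  exact hb _ ⟨_, (A.toFun ω).length_run past os, rfl⟩

theorem integral_geomAvg (μ : Measure Ω) (n : ℕ) (f : Ω → ℕ → ℝ)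
    (hf : ∀ l, Integrable (fun ω => f ω l) μ) :
    ∫ ω, geomAvg n (f ω) ∂μ = geomAvg n fun l => ∫ ω, f ω l ∂μ := by
  unfold geomAvg
  rw [integral_add (integrable_finsetSum _ fun l _ => (hf l).const_mul _) ((hf n).const_mul _),
    integral_finsetSum _ fun l _ => (hf l).const_mul _]
  simp only [integral_const_mul]

theorem integrable_geomAvg (μ : Measure Ω) (n : ℕ) (f : Ω → ℕ → ℝ)
    (hf : ∀ l, Integrable (fun ω => f ω l) μ) : Integrable (fun ω => geomAvg n (f ω)) μ :=
  (integrable_finsetSum _ fun l _ => (hf l).const_mul _).add ((hf n).const_mul _)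

end Measure

/-! ### The adversary's choice of levels and the conclusion. -/

section Main

variable {k : ℕ} {Ω : Type*} [MeasurableSpace Ω]

/-- Expected progress minus `ρ` times the offline potential gains at least `2 - 4 * ρ * freshValue M
n` on average over the next level, so some level achieves it. Only expectations over the algorithm
enter, so the input is oblivious. -/
theorem exists_levels {n : ℕ} (hn : k = n + 1) (μ : Measure Ω) [IsProbabilityMeasure μ]
    (A : RandomizedSemiOnlineAlgorithm k (Fin (k + 1)) Ω) {C : Finset (Fin (k + 1))}
    (hC : C.card ≤ k) (t : ℕ → ℝ) (M : ℕ) {ρ : ℝ} (hρ : 0 ≤ ρ) (T : ℕ) :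
    ∃ ls : List ℕ, (∀ l ∈ ls, l < k) ∧
      ∫ ω, progress (A.toFun ω) C t [] ∂μ -
          ρ * 2 ^ (k + 2) * (1 / 2 * Ledger.potential M (Ledger.init M) n) +
          T * (2 - 4 * ρ * Ledger.freshValue M n) ≤
        ∫ ω, progress (A.toFun ω) C t ls ∂μ -
          ρ * 2 ^ (k + 2) * ((ledger M ls).u k + Ledger.potential M (ledger M ls) n / 2) := by
  induction T with
  | zero =>
    refine ⟨[], by simp, le_of_eq ?_⟩
    rw [show ledger M [] = Ledger.init M from rfl, show (Ledger.init M).u k = 0 from rfl]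
    push_cast; ring
  | succ T ih =>
    obtain ⟨ls, hls, h⟩ := ih
    have hint : ∀ ls, Integrable (fun ω => progress (A.toFun ω) C t ls) μ := fun ls =>
      A.integrable_run μ [] (history k t ls) fun S =>
        evictionCost (expWeight k) C S - 2 ^ topHole (lastCache C S)
    have h1 : ∫ ω, progress (A.toFun ω) C t ls ∂μ + 2 ≤
        geomAvg n fun l => ∫ ω, progress (A.toFun ω) C t (ls ++ [l]) ∂μ := by
      rw [← integral_geomAvg μ n _ fun l => hint _]
      have : ∫ ω, (progress (A.toFun ω) C t ls + 2) ∂μ = ∫ ω, progress (A.toFun ω) C t ls ∂μ + 2 := by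
        rw [integral_add (hint _) (integrable_const _)]; simp
      rw [← this]
      exact integral_mono ((hint _).add (integrable_const _))
        (integrable_geomAvg μ n _ fun l => hint _)
        fun ω => progress_add_two_le hn (A.toFun ω) hC t ls
    have h2 := geomAvg_ledger_le M n (ledger M ls)
    have hc : 0 ≤ ρ * 2 ^ (k + 2) := by positivity
    have h3 := mul_le_mul_of_nonneg_left h2 hc
    have h4 : ρ * 2 ^ (k + 2) * ((1 / 2) ^ n * (Ledger.freshValue M n / 2)) =
        4 * ρ * Ledger.freshValue M n := by
      have : (2 : ℝ) ^ (k + 2) * (1 / 2) ^ n = 8 := by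
        rw [hn, show n + 1 + 2 = n + 3 from rfl, pow_add, mul_right_comm, ← mul_pow]; norm_num
      linear_combination ρ * Ledger.freshValue M n / 2 * this
    rw [← geomAvg_mul_left] at h3
    have h5 := geomAvg_sub n (fun l => ∫ ω, progress (A.toFun ω) C t (ls ++ [l]) ∂μ)
      (fun l => ρ * 2 ^ (k + 2) * (((ledger M ls).close M l).u (n + 1) +
        Ledger.potential M ((ledger M ls).close M l) n / 2))
    obtain ⟨l, hl, h6⟩ := exists_le_of_geomAvg_le h5.ge
    refine ⟨ls ++ [l], ?_, ?_⟩
    · intro i hi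
      rcases List.mem_append.1 hi with hi | hi
      · exact hls i hi
      · rw [List.mem_singleton.1 hi]; omega
    · rw [ledger_append_singleton]
      have hu : ∀ s : Ledger, s.u k = s.u (n + 1) := fun s => by rw [hn]
      rw [hu] at h ⊢
      push_cast
      linarith

/-- Otherwise the gap between online and offline cost would grow linearly in the number of steps,
past any additive constant. The larger `ρ'` serves because `ρ` may be negative. -/
theorem two_le_of_isCompetitive {n : ℕ} (hn : k = n + 1) (μ : Measure Ω) [IsProbabilityMeasure μ]
    (A : RandomizedSemiOnlineAlgorithm k (Fin (k + 1)) Ω) {C : Finset (Fin (k + 1))}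
    (hC : C.card ≤ k) (M : ℕ) {ρ ρ' : ℝ} (hρ : 0 ≤ ρ') (hle : ρ ≤ ρ')
    (hA : A.IsCompetitive μ (expWeight k) C ρ) : 2 ≤ 4 * ρ' * Ledger.freshValue M n := by
  by_contra! hlt
  obtain ⟨α, hα⟩ := hA
  set t : ℕ → ℝ := fun i => i with ht
  have htm : StrictMono t := Nat.strictMono_cast
  set B := 2 ^ k + 4 + ∑ p, expWeight k p
  set J := ∫ ω, progress (A.toFun ω) C t [] ∂μ -
    ρ' * 2 ^ (k + 2) * (1 / 2 * Ledger.potential M (Ledger.init M) n)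
  set W := ∑ p, expWeight k p
  have hbound : ∀ T : ℕ, J + T * (2 - 4 * ρ' * Ledger.freshValue M n) ≤ ρ' * B + α + W := by
    intro T
    obtain ⟨ls, hls, h⟩ := exists_levels hn μ A hC t M hρ T
    change J + _ ≤ _ at h
    have h1 := hα (gen k t ls) (isInput_gen htm ls).1
    have h2 := optCost_gen_le (by omega) M t hls C
    have h3 : ρ * optCost k (expWeight k) C (gen k t ls) ≤
        ρ' * (2 ^ (k + 2) * (ledger M ls).u k + B) :=
      (mul_le_mul_of_nonneg_right hle (optCost_nonneg _ _)).trans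
        (mul_le_mul_of_nonneg_left h2 hρ)
    have h4 : ∫ ω, progress (A.toFun ω) C t ls ∂μ ≤
        A.expectedCost μ (expWeight k) C (gen k t ls) + W := by
      have hint : Integrable (fun ω => cost (expWeight k) C ((A.toFun ω).solution (gen k t ls))) μ :=
        A.integrable_run μ [] _ fun S => cost (expWeight k) C S
      have e : A.expectedCost μ (expWeight k) C (gen k t ls) + W =
          ∫ ω, (cost (expWeight k) C ((A.toFun ω).solution (gen k t ls)) + W) ∂μ := by
        rw [integral_add hint (integrable_const _)]
        simp [RandomizedSemiOnlineAlgorithm.expectedCost]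
      rw [e]
      exact integral_mono (A.integrable_run μ [] (history k t ls) fun S =>
        evictionCost (expWeight k) C S - 2 ^ topHole (lastCache C S))
        (hint.add (integrable_const _)) fun ω => progress_le_cost (A.toFun ω) C t hls
    have h5 : 0 ≤ ρ' * 2 ^ (k + 2) * (Ledger.potential M (ledger M ls) n / 2) := by
      have := Ledger.potential_nonneg M (ledger M ls) (ledger_u_nonneg M ls) n
      positivity
    linarith
  obtain ⟨T, hT⟩ := exists_nat_gt ((ρ' * B + α + W - J) / (2 - 4 * ρ' * Ledger.freshValue M n))
  rw [div_lt_iff₀ (by linarith)] at hT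
  have := hbound T
  linarith

end Main

end WeightedCaching

open WeightedCaching in
theorem mainTheorem5 :
    ∃ c : ℝ, 0 < c ∧ ∀ k : ℕ, 1 ≤ k →
      ∃ w : Fin (k + 1) → ℝ, (∀ i, 0 < w i) ∧
        ∀ C₀ : Finset (Fin (k + 1)), C₀.card ≤ k →
        ∀ (Ω : Type*) [MeasurableSpace Ω] (μ : Measure Ω) [IsProbabilityMeasure μ]
          (A : WeightedCaching.RandomizedSemiOnlineAlgorithm k (Fin (k + 1)) Ω) (ρ : ℝ),
          A.IsCompetitive μ w C₀ ρ → c * Real.log k ≤ ρ := by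
  refine ⟨1 / 16, by norm_num, fun k hk => ⟨expWeight k, fun i => by unfold expWeight; positivity,
    fun C hC Ω _ μ _ A ρ hA => ?_⟩⟩
  by_contra! hlt
  obtain ⟨n, hn⟩ := Nat.exists_eq_add_of_le' hk
  have hlog : 0 ≤ Real.log k := Real.log_natCast_nonneg k
  -- The largest convenient choice with `2 ^ M ≤ n = k - 1`, apart from small `k`, where `M = 0`.
  set M := Nat.log 2 k - 1 with hM
  have h1 := two_le_of_isCompetitive hn μ A hC M (by positivity) hlt.le hA
  have h2 : Ledger.freshValue M n ≤ 4 / (M + 2) := by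
    apply Ledger.freshValue_le
    rcases Nat.eq_zero_or_pos M with h | h
    · exact Or.inr h
    · left
      have h3 : 2 ^ (M + 1) ≤ k := by
        rw [show M + 1 = Nat.log 2 k by omega]
        exact Nat.pow_log_le_self 2 (by omega)
      have : 1 ≤ 2 ^ M := Nat.one_le_two_pow
      rw [pow_succ] at h3; omega
  have h3 : Real.log k ≤ M + 2 := by
    have h4 : (k : ℝ) ≤ 2 ^ (M + 2) := by
      have : k < 2 ^ (Nat.log 2 k + 1) := Nat.lt_pow_succ_log_self (by norm_num) k
      have h5 : 2 ^ (Nat.log 2 k + 1) ≤ 2 ^ (M + 2) := Nat.pow_le_pow_right (by norm_num) (by omega)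
      exact_mod_cast this.le.trans h5
    have h6 : Real.log k ≤ (M + 2) * Real.log 2 := by
      have := Real.log_le_log (by exact_mod_cast hk) h4
      rw [Real.log_pow] at this
      exact_mod_cast this
    have h7 := Real.log_two_lt_d9
    have h8 : (0 : ℝ) < M + 2 := by positivity
    nlinarith
  -- The constant `1 / 16` cancels the factor `4` here and the `4` in `freshValue_le`, leaving `1 <
  -- 2`.
  have h4 : 4 * (1 / 16 * Real.log k) * Ledger.freshValue M n ≤ 1 := by
    have h8 : (0 : ℝ) < M + 2 := by positivity
    calc 4 * (1 / 16 * Real.log k) * Ledger.freshValue M n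
        ≤ 4 * (1 / 16 * (M + 2)) * (4 / (M + 2)) := by
          have := Ledger.freshValue_nonneg M n
          gcongr
      _ = 1 := by field_simp; norm_num
  linarith
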